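/- Fix an integer $h\ge 1$. A file of $nh$ packets over a finite field $\mathrm{GF}(q)$ is split into $n\ge 1$ generations of $h$ packets each. Coded packets are received one after another; independently for each of them, a generation is chosen uniformly at random among the $n$ generations, and a coding vector $e\in \mathrm{GF}(q)^h$ is chosen with independent, uniformly distributed entries (independently of the generation); the coded packet is the linear combination, with coefficients $e$, of the packets of the chosen generation, and the receiver learns $e$ and the index of the generation. A received packet contributes one degree of freedom to its generation if its coding vector is not in the linear span of the coding vectors received earlier from the same generation. Decoding fails after $t$ coded packets if, among the first $t$ packets, some generation has collected fewer than $h$ degrees of freedom. Let $P_{\mathrm{fail}}(n,h,q,t)$ be the probability of this event. Then there is a sequence $(E_h(n))_{n\ge1}$ of real numbers, depending on $h$ only (and not on $q$ or $t$), with $$E_h(n)=\mathcal{O}\!\left(\frac{\log\log n}{\log n}\right)\qquad (n\to\infty),$$ such that for every prime power $q$, every $n\ge 1$ and every integer $t\ge 0$, $$P_{\mathrm{fail}}(n,h,q,t)\;>\;1-\exp\!\left[-\frac{1}{(h-1)!}\,n(\log n)^{h-1}e^{-t/n}\right]+E_h(n).$$ -/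

import Mathlib

namespace CodingOverGenerations

open MeasureTheory ProbabilityTheory

/-- What the receiver learns about one coded packet: the index of the generation that was
combined (one of `n`) and the coding vector (of length `h`, over the finite field `F`). -/
abbrev CodedPacket (n h : ℕ) (F : Type*) : Type _ := Fin n × (Fin h → F)

/-- `X 0, X 1, …` are the coded packets sent by the source: they are independent, and in each
of them the generation is uniform on the `n` generations and, independently, the `h` entries of
the coding vector are independent and uniform on `F`. -/
structure IsCodedStream {n h : ℕ} {F Ω : Type*} [MeasurableSpace F] [MeasurableSpace Ω]
    (P : Measure Ω) (X : ℕ → Ω → CodedPacket n h F) : Prop where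
  measurable : ∀ i, Measurable (X i)
  indep : iIndepFun X P
  law : ∀ i, P.map (X i) =
    (uniformOn (Set.univ : Set (Fin n))).prod
      (Measure.pi fun _ : Fin h => uniformOn (Set.univ : Set F))

/-- The coding vectors from generation `j` among the packets received before the `i`-th one. -/
def previousVectors {n h : ℕ} {F : Type*} (x : ℕ → CodedPacket n h F) (j : Fin n) (i : ℕ) :
    Set (Fin h → F) :=
  {v | ∃ k < i, (x k).1 = j ∧ (x k).2 = v}

/-- The `i`-th packet brings one more degree of freedom for generation `j`: it comes from that
generation, and its coding vector is linearly independent of (is not a linear combination of) the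
coding vectors received earlier from that generation. -/
def IsInnovative {n h : ℕ} {F : Type*} [Field F] (x : ℕ → CodedPacket n h F) (j : Fin n)
    (i : ℕ) : Prop :=
  (x i).1 = j ∧ (x i).2 ∉ Submodule.span F (previousVectors x j i)

open Classical in
/-- The number of degrees of freedom collected for generation `j` in the first `t` packets. -/
noncomputable def degreesOfFreedom {n h : ℕ} {F : Type*} [Field F]
    (x : ℕ → CodedPacket n h F) (j : Fin n) (t : ℕ) : ℕ :=
  ((Finset.range t).filter fun i => IsInnovative x j i).card

/-- The first `t` packets suffice to decode the whole file: `h` degrees of freedom have been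
collected for every generation. -/
def Decodable {n h : ℕ} {F : Type*} [Field F] (x : ℕ → CodedPacket n h F) (t : ℕ) : Prop :=
  ∀ j : Fin n, h ≤ degreesOfFreedom x j t

/-- The probability of decoding failure when `t` coded packets have been collected. -/
noncomputable def failureProbability {n h : ℕ} {F Ω : Type*} [Field F] [MeasurableSpace Ω]
    (P : Measure Ω) (X : ℕ → Ω → CodedPacket n h F) (t : ℕ) : ℝ :=
  P.real {ω | ¬ Decodable (fun i => X i ω) t}

end CodingOverGenerations

namespace CodingOverGenerations

open MeasureTheory ProbabilityTheory

/-! Coding vectors can only hurt: a generation with `h` degrees of freedom has received at least `h`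
packets. So failure is at least as likely as in the occupancy problem of throwing `t` balls into `n`
bins, and the field drops out.

Write `k = h - 1`. Large counts in different bins are negatively dependent
(`measureReal_receivedCount_le`), so the probability that all bins hold more than `k` balls is at
most a product of `n` binomial tails. By `binomialTail_succ_le` and `1 - y ≤ exp (-y)`, the product
is at most `exp (-m)` with `m = n * (t.choose k * (1/n)^k * (1 - 1/n)^t)`.

It remains to replace `m` by `n (log n)^k e^{-t/n} / k!`, uniformly in `t`. Between `n log n` and `2
n log n` a direct estimate works. Below (for `k > 0`), success already has probability `O(1 / log
n)`, by monotonicity in `t`; above, the target exponential is within `1 / log n` of `1`. The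
resulting error `O(1 / log n)` is stronger than required. -/

/-- The number of packets from generation `j` among the first `t`, where `y i` is the generation
of the `i`-th packet. -/
def receivedCount {n : ℕ} (y : ℕ → Fin n) (j : Fin n) (t : ℕ) : ℕ :=
  ((Finset.range t).filter fun i => y i = j).card

/-- The probability that a binomial variable with `t` trials and success probability `x` is at
least `a`. -/
noncomputable def binomialTail (x : ℝ) : ℕ → ℕ → ℝ
  | 0, 0 => 1
  | 0, _ + 1 => 0
  | t + 1, a => (1 - x) * binomialTail x t a + x * binomialTail x t (a - 1)

/-! ### Packet counts per generation -/

section Counting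

variable {n h : ℕ} {F : Type*} [Field F]

theorem receivedCount_zero (y : ℕ → Fin n) (j : Fin n) : receivedCount y j 0 = 0 := by
  simp [receivedCount]

theorem receivedCount_succ (y : ℕ → Fin n) (j : Fin n) (t : ℕ) :
    receivedCount y j (t + 1) = receivedCount y j t + if y t = j then 1 else 0 := by
  unfold receivedCount
  rw [Finset.range_add_one, Finset.filter_insert]
  split_ifs <;> simp

theorem receivedCount_mono (y : ℕ → Fin n) (j : Fin n) {s t : ℕ} (hst : s ≤ t) :
    receivedCount y j s ≤ receivedCount y j t :=
  Finset.card_le_card (Finset.filter_subset_filter _ (Finset.range_mono hst))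

theorem receivedCount_congr {y z : ℕ → Fin n} {t : ℕ} (hyz : ∀ i < t, y i = z i) (j : Fin n) :
    receivedCount y j t = receivedCount z j t := by
  unfold receivedCount
  congr 1
  refine Finset.filter_congr fun i hi => ?_
  rw [hyz i (Finset.mem_range.1 hi)]

theorem degreesOfFreedom_le_receivedCount (x : ℕ → CodedPacket n h F) (j : Fin n) (t : ℕ) :
    degreesOfFreedom x j t ≤ receivedCount (fun i => (x i).1) j t := by
  classical
  unfold degreesOfFreedom receivedCount
  exact Finset.card_le_card fun i hi => by
    simp only [Finset.mem_filter] at hi ⊢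
    exact ⟨hi.1, hi.2.1⟩

end Counting

/-! ### Binomial tails -/

section BinomialTail

variable {x : ℝ}

theorem binomialTail_nonneg (h0 : 0 ≤ x) (h1 : x ≤ 1) (t a : ℕ) : 0 ≤ binomialTail x t a := by
  induction t generalizing a with
  | zero => cases a <;> simp [binomialTail]
  | succ t ih =>
    rw [binomialTail]
    exact add_nonneg (mul_nonneg (by linarith) (ih _)) (mul_nonneg h0 (ih _))

theorem binomialTail_le_pred (h0 : 0 ≤ x) (h1 : x ≤ 1) (t a : ℕ) :
    binomialTail x t a ≤ binomialTail x t (a - 1) := by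
  induction t generalizing a with
  | zero => rcases a with _ | _ | a <;> simp [binomialTail]
  | succ t ih =>
    simp only [binomialTail]
    exact add_le_add (mul_le_mul_of_nonneg_left (ih _) (by linarith))
      (mul_le_mul_of_nonneg_left (ih _) h0)

theorem binomialTail_zero_right (x : ℝ) (t : ℕ) : binomialTail x t 0 = 1 := by
  induction t with
  | zero => simp [binomialTail]
  | succ t ih => simp [binomialTail, ih]

/-- The subtracted term is the probability of exactly `a` successes, with `(1 - x)^(t - a)` weakened
to `(1 - x)^t`; this form passes through the induction by Pascal's rule. -/
theorem binomialTail_succ_le (h0 : 0 ≤ x) (h1 : x ≤ 1) (t a : ℕ) :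
    binomialTail x t (a + 1) ≤ 1 - t.choose a * x ^ a * (1 - x) ^ t := by
  induction t generalizing a with
  | zero => cases a <;> simp [binomialTail]
  | succ t ih =>
    have hx : 0 ≤ 1 - x := by linarith
    simp only [binomialTail, Nat.add_sub_cancel]
    cases a with
    | zero =>
      have := mul_le_mul_of_nonneg_left (ih 0) hx
      simp only [binomialTail_zero_right, Nat.choose_zero_right, pow_succ] at this ⊢
      norm_num at this ⊢
      linarith
    | succ a =>
      have e1 := mul_le_mul_of_nonneg_left (ih (a + 1)) hx
      have e2 := mul_le_mul_of_nonneg_left (ih a) h0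
      have e3 : 0 ≤ x * ((t.choose a : ℝ) * x ^ (a + 1) * (1 - x) ^ t) := by positivity
      rw [Nat.choose_succ_succ]
      push_cast
      refine (add_le_add e1 e2).trans ?_
      have e4 : 1 - ((t.choose a : ℝ) + t.choose (a + 1)) * x ^ (a + 1) * (1 - x) ^ (t + 1)
          - ((1 - x) * (1 - t.choose (a + 1) * x ^ (a + 1) * (1 - x) ^ t)
            + x * (1 - t.choose a * x ^ a * (1 - x) ^ t))
          = x * ((t.choose a : ℝ) * x ^ (a + 1) * (1 - x) ^ t) := by ring
      linarith

end BinomialTail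

/-- The first-order terms of `∏ i, (u i + x * (v i - u i))`, as a polynomial in `x`, are a lower
bound for it when `0 ≤ u ≤ v` and `0 ≤ x`. -/
theorem sum_prod_ite_add_le_prod {ι : Type*} [DecidableEq ι] {x : ℝ} (h0 : 0 ≤ x)
    {u v : ι → ℝ} (hu : ∀ i, 0 ≤ u i) (huv : ∀ i, u i ≤ v i) (s : Finset ι) :
    (∑ j ∈ s, x * ∏ i ∈ s, if i = j then v i else u i) + (1 - s.card * x) * ∏ i ∈ s, u i
      ≤ ∏ i ∈ s, ((1 - x) * u i + x * v i) := by
  induction s using Finset.induction_on with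
  | empty => simp
  | insert b s hb ih =>
    -- Passing from `u b` to the new factor adds `x * (v b - u b)`, which multiplies `∏ u` on the
    -- left and the full product on the right.
    have hle : ∏ i ∈ s, u i ≤ ∏ i ∈ s, ((1 - x) * u i + x * v i) :=
      Finset.prod_le_prod (fun i _ => hu i) fun i _ => by
        nlinarith [mul_nonneg h0 (sub_nonneg.2 (huv i))]
    have e1 : ∏ i ∈ s, (if i = b then v i else u i) = ∏ i ∈ s, u i :=
      Finset.prod_congr rfl fun i hi => if_neg (ne_of_mem_of_not_mem hi hb)
    have e2 : ∑ j ∈ s, x * ∏ i ∈ insert b s, (if i = j then v i else u i)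
        = u b * ∑ j ∈ s, x * ∏ i ∈ s, (if i = j then v i else u i) := by
      rw [Finset.mul_sum]
      refine Finset.sum_congr rfl fun j hj => ?_
      rw [Finset.prod_insert hb, if_neg (ne_of_mem_of_not_mem hj hb).symm]
      ring
    rw [Finset.sum_insert hb, e2, Finset.prod_insert hb, Finset.prod_insert hb,
      Finset.prod_insert hb, Finset.card_insert_of_notMem hb, e1, if_pos rfl]
    push_cast
    have e3 := mul_le_mul_of_nonneg_left ih (hu b)
    have e4 := mul_le_mul_of_nonneg_left hle (mul_nonneg h0 (sub_nonneg.2 (huv b)))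
    linarith

/-! ### Negative dependence of the occupancy counts -/

section Probability

variable {n h : ℕ} {F Ω : Type*} [MeasurableSpace F] [MeasurableSpace Ω] {P : Measure Ω}

theorem measurableSet_receivedCount {Y : ℕ → Ω → Fin n} (hY : ∀ i, Measurable (Y i))
    (t : ℕ) (a : Fin n → ℕ) :
    MeasurableSet {ω | ∀ j, a j ≤ receivedCount (fun i => Y i ω) j t} := by
  have hm : ∀ j, Measurable fun ω => receivedCount (fun i => Y i ω) j t := by
    intro j
    induction t with
    | zero => simp only [receivedCount_zero]; exact measurable_const
    | succ t ih =>
      simp only [receivedCount_succ]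
      exact ih.add (Measurable.ite (hY t (measurableSet_singleton j)) measurable_const
        measurable_const)
  rw [Set.ofPred_forall]
  exact MeasurableSet.iInter fun j => measurableSet_le measurable_const (hm j)

/-- The event that the counts after `t` packets are large is independent of the next packet. -/
theorem measureReal_next_inter_receivedCount {Y : ℕ → Ω → Fin n} (hY : ∀ i, Measurable (Y i))
    (hind : iIndepFun Y P) (t : ℕ) (a : Fin n → ℕ) (j : Fin n) :
    P.real ({ω | Y t ω = j} ∩ {ω | ∀ i, a i ≤ receivedCount (fun m => Y m ω) i t})
      = P.real {ω | Y t ω = j}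
        * P.real {ω | ∀ i, a i ≤ receivedCount (fun m => Y m ω) i t} := by
  have hI := hind.indepFun_finset {t} (Finset.range t) (by simp) hY
  -- The default `j` outside the range is never counted.
  let S : Set (Finset.range t → Fin n) :=
    {y | ∀ i, a i ≤ receivedCount (fun m => if hm : m ∈ Finset.range t then y ⟨m, hm⟩ else j) i t}
  let T : Set (({t} : Finset ℕ) → Fin n) := {y | y ⟨t, by simp⟩ = j}
  have hS : (fun ω (i : Finset.range t) => Y i ω) ⁻¹' S
      = {ω | ∀ i, a i ≤ receivedCount (fun m => Y m ω) i t} := by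
    ext ω
    simp only [S, Set.mem_preimage, Set.mem_ofPred_eq]
    refine forall_congr' fun i => ?_
    rw [receivedCount_congr (z := fun m => Y m ω)]
    intro m hm
    simp [hm]
  have key := hI.measure_inter_preimage_eq_mul T S (Set.toFinite _).measurableSet
    (Set.toFinite _).measurableSet
  rw [hS] at key
  have := congrArg ENNReal.toReal key
  rw [ENNReal.toReal_mul] at this
  exact this

/-- Occupancy counts of independent uniform throws are negatively upper orthant dependent. -/
theorem measureReal_receivedCount_le [IsProbabilityMeasure P] {Y : ℕ → Ω → Fin n}
    (hY : ∀ i, Measurable (Y i)) (hind : iIndepFun Y P)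
    (hlaw : ∀ i j, P.real {ω | Y i ω = j} = 1 / n) (hn : 1 ≤ n) (t : ℕ) (a : Fin n → ℕ) :
    P.real {ω | ∀ j, a j ≤ receivedCount (fun i => Y i ω) j t}
      ≤ ∏ j, binomialTail (1 / n) t (a j) := by
  have hn' : (1 : ℝ) ≤ n := by exact_mod_cast hn
  have h0 : (0 : ℝ) ≤ 1 / n := by positivity
  have h1 : (1 : ℝ) / n ≤ 1 := by rw [div_le_one (by linarith)]; exact hn'
  induction t generalizing a with
  | zero =>
    by_cases ha : ∀ j, a j = 0
    · simp [ha, binomialTail]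
    · push Not at ha
      obtain ⟨j, hj⟩ := ha
      have : {ω | ∀ j, a j ≤ receivedCount (fun i => Y i ω) j 0} = ∅ := by
        ext ω
        simp only [receivedCount_zero, Set.mem_ofPred_eq, Set.mem_empty_iff_false, iff_false]
        exact fun hω => hj (Nat.le_zero.1 (hω j))
      rw [this, measureReal_empty]
      exact Finset.prod_nonneg fun j _ => binomialTail_nonneg h0 h1 _ _
  | succ t ih =>
    -- Thresholds left for the first `t` packets when the last one falls in generation `j`.
    let b : Fin n → Fin n → ℕ := fun j i => if i = j then a i - 1 else a i
    have hsub : {ω | ∀ j, a j ≤ receivedCount (fun i => Y i ω) j (t + 1)} ⊆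
        ⋃ j, ({ω | Y t ω = j} ∩ {ω | ∀ i, b j i ≤ receivedCount (fun m => Y m ω) i t}) := by
      intro ω hω
      simp only [Set.mem_iUnion]
      refine ⟨Y t ω, rfl, fun i => ?_⟩
      have := hω i
      simp only [receivedCount_succ] at this
      simp only [b]
      by_cases hi : i = Y t ω
      · rw [if_pos hi]; rw [if_pos hi.symm] at this; omega
      · rw [if_neg hi]; rw [if_neg (Ne.symm hi)] at this; omega
    calc P.real {ω | ∀ j, a j ≤ receivedCount (fun i => Y i ω) j (t + 1)}
        ≤ ∑ j, P.real ({ω | Y t ω = j} ∩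
            {ω | ∀ i, b j i ≤ receivedCount (fun m => Y m ω) i t}) :=
          (measureReal_mono hsub).trans (measureReal_iUnion_fintype_le _)
      _ = ∑ j, (1 / n : ℝ) * P.real {ω | ∀ i, b j i ≤ receivedCount (fun m => Y m ω) i t} :=
          Finset.sum_congr rfl fun j _ => by
            rw [measureReal_next_inter_receivedCount hY hind, hlaw]
      _ ≤ ∑ j, (1 / n : ℝ) * ∏ i, binomialTail (1 / n) t (b j i) :=
          Finset.sum_le_sum fun j _ => mul_le_mul_of_nonneg_left (ih _) h0
      _ ≤ ∏ j, binomialTail (1 / n) (t + 1) (a j) := by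
          have := sum_prod_ite_add_le_prod h0 (fun i => binomialTail_nonneg h0 h1 t (a i))
            (fun i => binomialTail_le_pred h0 h1 t (a i)) Finset.univ
          -- The last packet surely hits some generation, so the zeroth-order term vanishes.
          have hc : (1 : ℝ) - n * (1 / n) = 0 := by field_simp; simp
          rw [Finset.card_univ, Fintype.card_fin, hc, zero_mul, add_zero] at this
          refine le_trans (le_of_eq ?_) this
          refine Finset.sum_congr rfl fun j _ => ?_
          congr 1
          refine Finset.prod_congr rfl fun i _ => ?_
          simp only [b]
          split_ifs <;> rfl

theorem IsCodedStream.measureReal_generation_eq [Fintype F] [Nonempty F]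
    [MeasurableSingletonClass F] {X : ℕ → Ω → CodedPacket n h F} (hX : IsCodedStream P X)
    (i : ℕ) (j : Fin n) : P.real {ω | (X i ω).1 = j} = 1 / n := by
  have : Nonempty (Fin n) := ⟨j⟩
  have : IsProbabilityMeasure (uniformOn (Set.univ : Set F)) :=
    isProbabilityMeasure_uniformOn Set.finite_univ Set.univ_nonempty
  have e : {ω | (X i ω).1 = j} = X i ⁻¹' (({j} : Set (Fin n)) ×ˢ Set.univ) := by
    ext ω; simp
  rw [e, measureReal_def, ← Measure.map_apply (hX.measurable i)
    ((measurableSet_singleton j).prod MeasurableSet.univ), hX.law, Measure.prod_prod,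
    uniformOn_univ]
  simp

theorem IsCodedStream.measureReal_receivedCount_le_exp [Fintype F] [Nonempty F]
    [MeasurableSingletonClass F] [IsProbabilityMeasure P] {X : ℕ → Ω → CodedPacket n h F}
    (hX : IsCodedStream P X) (hn : 1 ≤ n) (k t : ℕ) :
    P.real {ω | ∀ j, k + 1 ≤ receivedCount (fun i => (X i ω).1) j t}
      ≤ Real.exp (-(n * (t.choose k * (1 / n) ^ k * (1 - 1 / n) ^ t))) := by
  have hn' : (1 : ℝ) ≤ n := by exact_mod_cast hn
  have h0 : (0 : ℝ) ≤ 1 / n := by positivity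
  have h1 : (1 : ℝ) / n ≤ 1 := by rw [div_le_one (by linarith)]; exact hn'
  have hind : iIndepFun (fun i ω => (X i ω).1) P :=
    hX.indep.comp (fun _ => Prod.fst) fun _ => measurable_fst
  have key := measureReal_receivedCount_le (fun i => measurable_fst.comp (hX.measurable i)) hind
    (fun i j => hX.measureReal_generation_eq i j) hn t fun _ => k + 1
  refine key.trans ?_
  rw [Finset.prod_const, Finset.card_univ, Fintype.card_fin, ← mul_neg, Real.exp_nat_mul]
  refine pow_le_pow_left₀ (binomialTail_nonneg h0 h1 _ _) ?_ n
  refine (binomialTail_succ_le h0 h1 t k).trans ?_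
  have := Real.add_one_le_exp (-((t.choose k : ℝ) * (1 / n) ^ k * (1 - 1 / n) ^ t))
  linarith

/-- Decoding succeeds no more often than every generation gets at least `h` packets. -/
theorem one_sub_le_failureProbability [Field F] [IsProbabilityMeasure P]
    {X : ℕ → Ω → CodedPacket n h F} (hX : ∀ i, Measurable (X i)) (t : ℕ) :
    1 - P.real {ω | ∀ j, h ≤ receivedCount (fun i => (X i ω).1) j t}
      ≤ failureProbability P X t := by
  rw [← probReal_compl_eq_one_sub
    (measurableSet_receivedCount (Y := fun i ω => (X i ω).1)
      (fun i => measurable_fst.comp (hX i)) t fun _ => h)]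
  refine measureReal_mono fun ω hω hdec => hω fun j => ?_
  exact (hdec j).trans (degreesOfFreedom_le_receivedCount _ j t)

end Probability

/-! ### Asymptotics, uniform in the number of packets -/

section Asymptotics

/-- A relative error in the exponent costs only an absolute error, uniformly in `a`: the loss is at
most `ε * a * exp (-(a * (1 - ε)))`, and `y * exp (-y) ≤ 1`. -/
theorem exp_neg_mul_le_exp_neg_add {a ε : ℝ} (hε : 0 ≤ ε) (hε' : ε ≤ 1 / 2) :
    Real.exp (-(a * (1 - ε))) ≤ Real.exp (-a) + 2 * ε := by
  have h1 : Real.exp (-(a * (1 - ε))) * (1 - a * ε) ≤ Real.exp (-a) := by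
    have := Real.add_one_le_exp (-(a * ε))
    calc _ ≤ Real.exp (-(a * (1 - ε))) * Real.exp (-(a * ε)) :=
          mul_le_mul_of_nonneg_left (by linarith) (Real.exp_pos _).le
      _ = Real.exp (-a) := by rw [← Real.exp_add]; ring_nf
  have h2 : Real.exp (-(a * (1 - ε))) * (a * (1 - ε)) ≤ 1 := by
    have := Real.add_one_le_exp (a * (1 - ε))
    rw [Real.exp_neg, inv_mul_le_iff₀ (Real.exp_pos _)]
    linarith
  have h3 : Real.exp (-(a * (1 - ε))) * a ≤ 2 := by
    by_cases ha : 0 ≤ a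
    · have : 0 ≤ Real.exp (-(a * (1 - ε))) * (a * (1 / 2 - ε)) :=
        mul_nonneg (Real.exp_pos _).le (mul_nonneg ha (by linarith))
      nlinarith
    · nlinarith [Real.exp_pos (-(a * (1 - ε)))]
  nlinarith

/-- Raise `1 - x^2 ≤ exp x * (1 - x)`, with `x = 1 / n`, to the power `t` and apply Bernoulli's
inequality. -/
theorem exp_neg_mul_one_sub_le_pow {n : ℕ} (hn : 1 ≤ n) (t : ℕ) :
    Real.exp (-((t : ℝ) / n)) * (1 - t / n ^ 2) ≤ (1 - 1 / (n : ℝ)) ^ t := by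
  have hn' : (1 : ℝ) ≤ n := by exact_mod_cast hn
  have h1 : (1 : ℝ) / n ≤ 1 := by rw [div_le_one (by linarith)]; exact hn'
  have h0 : (0 : ℝ) ≤ 1 / n := by positivity
  set x : ℝ := 1 / n with hx
  have hx2 : x ^ 2 ≤ 1 := by nlinarith
  have hb : 1 - t * x ^ 2 ≤ (1 - x ^ 2) ^ t := by
    have := one_add_mul_le_pow (a := -x ^ 2) (by linarith) t
    linarith [show (1 : ℝ) + t * -x ^ 2 = 1 - t * x ^ 2 by ring,
      show (1 + -x ^ 2 : ℝ) ^ t = (1 - x ^ 2) ^ t by rw [← sub_eq_add_neg]]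
  have hexp : 1 - x ^ 2 ≤ Real.exp x * (1 - x) := by
    nlinarith [Real.add_one_le_exp x]
  have e1 : (t : ℝ) / n ^ 2 = t * x ^ 2 := by rw [hx]; field_simp
  have e2 : (t : ℝ) / n = t * x := by rw [hx]; field_simp
  rw [e1, e2, Real.exp_neg, inv_mul_le_iff₀ (Real.exp_pos _), Real.exp_nat_mul, ← mul_pow]
  exact hb.trans (pow_le_pow_left₀ (by linarith) hexp t)

/-- Combines `t.choose k ≥ (t - k)^k / k!` with Bernoulli's inequality for `(1 - k / n)^k`. For `k =
0` both sides are `1`, whatever `t` is. -/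
theorem pow_div_factorial_mul_le_choose_mul {n k t : ℕ} {L : ℝ} (hn : 1 ≤ n) (hL : 1 ≤ L)
    (hk : (k : ℝ) ≤ n) (ht : k = 0 ∨ n * L ≤ t) :
    1 / (k.factorial : ℝ) * L ^ k * (1 - k ^ 2 / n) ≤ t.choose k * (1 / n) ^ k := by
  rcases ht with rfl | ht
  · simp
  have hn' : (1 : ℝ) ≤ n := by exact_mod_cast hn
  have hf : (0 : ℝ) < k.factorial := by exact_mod_cast k.factorial_pos
  have hnL : (n : ℝ) ≤ n * L := by nlinarith
  have hkt : k ≤ t := by exact_mod_cast (hk.trans hnL).trans ht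
  have h1 : ((t : ℝ) - k) ^ k / k.factorial ≤ t.choose k := by
    rw [Nat.choose_eq_descFactorial_div_factorial, Nat.cast_div (Nat.factorial_dvd_descFactorial _ _)
      hf.ne']
    have := Nat.pow_sub_le_descFactorial t k
    have h2 : ((t - k) ^ k : ℕ) ≤ t.descFactorial k :=
      (Nat.pow_le_pow_left (by omega) k).trans this
    have h3 : ((t : ℝ) - k) ^ k ≤ t.descFactorial k := by
      rw [← Nat.cast_sub hkt]; exact_mod_cast h2
    gcongr
  have h2 : 1 - (k : ℝ) ^ 2 / n ≤ (1 - k / n) ^ k := by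
    have hkn : (k : ℝ) / n ≤ 1 := by rw [div_le_one (by linarith)]; exact hk
    have := one_add_mul_le_pow (a := -((k : ℝ) / n)) (by linarith) k
    rw [← sub_eq_add_neg] at this
    linarith [show (1 : ℝ) + k * -((k : ℝ) / n) = 1 - k ^ 2 / n by ring]
  have h3 : L ^ k * (1 - k / n) ^ k ≤ ((t : ℝ) - k) ^ k * (1 / n) ^ k := by
    rw [← mul_pow, ← mul_pow]
    have hkn : 0 ≤ 1 - (k : ℝ) / n := by
      rw [sub_nonneg, div_le_one (by linarith)]; exact hk
    refine pow_le_pow_left₀ (by positivity) ?_ k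
    rw [mul_one_div, le_div_iff₀ (by linarith)]
    have : L * (1 - (k : ℝ) / n) * n = n * L - k * L := by field_simp
    nlinarith [(Nat.cast_nonneg k : (0 : ℝ) ≤ k)]
  calc 1 / (k.factorial : ℝ) * L ^ k * (1 - k ^ 2 / n)
      ≤ 1 / (k.factorial : ℝ) * L ^ k * (1 - k / n) ^ k := by gcongr
    _ = 1 / (k.factorial : ℝ) * (L ^ k * (1 - k / n) ^ k) := by ring
    _ ≤ 1 / (k.factorial : ℝ) * (((t : ℝ) - k) ^ k * (1 / n) ^ k) := by gcongr
    _ = ((t : ℝ) - k) ^ k / k.factorial * (1 / n) ^ k := by ring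
    _ ≤ t.choose k * (1 / n) ^ k := by gcongr

/-- In the range `n log n ≤ t ≤ 2 n log n` (or `t ≤ 2 n log n` if `k = 0`), the lower bound for the
mean number of deficient generations agrees with its asymptotic form up to `1 / log n`. -/
theorem exp_neg_choose_le {n k t : ℕ} (hn : 1 ≤ n) (hL : 1 ≤ Real.log n)
    (hlarge : (8 + 2 * k ^ 2) * Real.log n ^ (k + 2) ≤ n)
    (ht : k = 0 ∨ n * Real.log n ≤ t) (ht' : (t : ℝ) ≤ 2 * (n * Real.log n)) :
    Real.exp (-(n * (t.choose k * (1 / n) ^ k * (1 - 1 / n) ^ t)))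
      ≤ Real.exp (-(1 / (k.factorial : ℝ) * n * Real.log n ^ k * Real.exp (-((t : ℝ) / n))))
        + 1 / Real.log n := by
  set L := Real.log n with hLdef
  have hn' : (1 : ℝ) ≤ n := by exact_mod_cast hn
  have hn0 : (0 : ℝ) < n := by linarith
  have hk0 : (0 : ℝ) ≤ (k : ℝ) := Nat.cast_nonneg k
  have hL2 : L ^ 2 ≤ L ^ (k + 2) := pow_le_pow_right₀ hL (by omega)
  have hA : (8 + 2 * (k : ℝ) ^ 2) * L ^ 2 ≤ n :=
    (mul_le_mul_of_nonneg_left hL2 (by positivity)).trans hlarge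
  have hk : (k : ℝ) ≤ n := by nlinarith [sq_nonneg ((k : ℝ) - 1)]
  -- The sum of two relative errors: `t / n^2 ≤ 2 * L / n` from the power and `k^2 / n` from the
  -- binomial coefficient.
  set ε : ℝ := (2 * L + k ^ 2) / n with hε
  have hεL : 2 * ε ≤ 1 / L := by
    rw [hε, le_div_iff₀ (by linarith), mul_div_assoc', div_mul_eq_mul_div, div_le_one hn0]
    nlinarith [sq_nonneg (k : ℝ), mul_nonneg (sq_nonneg (k : ℝ)) (by linarith : 0 ≤ L)]
  have hε0 : 0 ≤ ε := by positivity
  have hε2 : ε ≤ 1 / 2 := by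
    have : 1 / L ≤ 1 := by rw [div_le_one (by linarith)]; exact hL
    linarith
  have h1 := exp_neg_mul_one_sub_le_pow hn t
  have h2 := pow_div_factorial_mul_le_choose_mul hn hL hk ht
  have hts : (t : ℝ) / n ^ 2 ≤ 2 * L / n := by
    rw [div_le_div_iff₀ (by positivity) hn0]
    nlinarith
  have hsplit : ε = 2 * L / n + k ^ 2 / n := by rw [hε]; ring
  have hp : 0 ≤ 2 * L / n := by positivity
  have hq : 0 ≤ (k : ℝ) ^ 2 / n := by positivity
  refine le_trans (Real.exp_le_exp.2 (neg_le_neg ?_))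
    ((exp_neg_mul_le_exp_neg_add (a := 1 / (k.factorial : ℝ) * n * L ^ k *
      Real.exp (-((t : ℝ) / n))) hε0 hε2).trans (by linarith))
  have h3 : Real.exp (-((t : ℝ) / n)) * (1 - 2 * L / n) ≤ (1 - 1 / (n : ℝ)) ^ t :=
    (mul_le_mul_of_nonneg_left (by linarith) (Real.exp_pos _).le).trans h1
  have h4 : 1 - ε ≤ (1 - k ^ 2 / n) * (1 - 2 * L / n) := by nlinarith
  have h5 : (1 / (k.factorial : ℝ) * L ^ k * (1 - k ^ 2 / n)) *
      (Real.exp (-((t : ℝ) / n)) * (1 - 2 * L / n))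
      ≤ (t.choose k * (1 / n) ^ k) * (1 - 1 / (n : ℝ)) ^ t :=
    mul_le_mul h2 h3 (mul_nonneg (Real.exp_pos _).le (by linarith)) (by positivity)
  calc 1 / (k.factorial : ℝ) * n * L ^ k * Real.exp (-((t : ℝ) / n)) * (1 - ε)
      ≤ 1 / (k.factorial : ℝ) * n * L ^ k * Real.exp (-((t : ℝ) / n)) *
          ((1 - k ^ 2 / n) * (1 - 2 * L / n)) :=
        mul_le_mul_of_nonneg_left h4 (by positivity)
    _ = n * ((1 / (k.factorial : ℝ) * L ^ k * (1 - k ^ 2 / n)) *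
      (Real.exp (-((t : ℝ) / n)) * (1 - 2 * L / n))) := by ring
    _ ≤ _ := mul_le_mul_of_nonneg_left h5 hn0.le

theorem le_exp_neg_add_of_le_exp_neg_choose {n k : ℕ} (hn : 1 ≤ n) (hL : 1 ≤ Real.log n)
    (hlarge : (8 + 2 * k ^ 2) * Real.log n ^ (k + 2) ≤ n) {g : ℕ → ℝ} (hg : Monotone g)
    (hg1 : ∀ t, g t ≤ 1)
    (hgexp : ∀ t : ℕ, g t ≤ Real.exp (-(n * (t.choose k * (1 / n) ^ k * (1 - 1 / n) ^ t))))
    (t : ℕ) :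
    g t ≤ Real.exp (-(1 / (k.factorial : ℝ) * n * Real.log n ^ k * Real.exp (-((t : ℝ) / n))))
        + (3 * k.factorial + 1) / Real.log n := by
  have hn' : (1 : ℝ) ≤ n := by exact_mod_cast hn
  have hn0 : (0 : ℝ) < n := by linarith
  have hf1 : (1 : ℝ) ≤ k.factorial := by exact_mod_cast k.factorial_pos
  have hLn : Real.exp (Real.log n) = n := Real.exp_log hn0
  set L := Real.log n with hLdef
  have hL0 : 0 < L := by linarith
  have hone : 1 / L ≤ (3 * k.factorial + 1) / L := by gcongr; linarith
  by_cases ht' : (t : ℝ) ≤ 2 * (n * L)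
  · by_cases ht : k = 0 ∨ n * L ≤ t
    · exact (hgexp t).trans ((exp_neg_choose_le hn hL hlarge ht ht').trans (by linarith))
    · push Not at ht
      obtain ⟨hk, ht⟩ := ht
      -- At `T` the mean is at least `L / (3 * k!)`, because `k ≥ 1`; hence `g T`, and with it `g
      -- t`, is `O(1 / L)`.
      set T := ⌈n * L⌉₊ with hT
      have hT1 : n * L ≤ T := Nat.le_ceil _
      have hT2 : (T : ℝ) < n * L + 1 := Nat.ceil_lt_add_one (by positivity)
      have htT : t ≤ T := by exact_mod_cast (ht.le.trans hT1)
      have hT3 : (T : ℝ) ≤ 2 * (n * L) := by nlinarith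
      have key := exp_neg_choose_le hn hL hlarge (Or.inr hT1) hT3
      have hexp : Real.exp (-1) ≤ n * Real.exp (-((T : ℝ) / n)) := by
        conv_rhs => rw [← hLn, ← Real.exp_add]
        refine Real.exp_le_exp.2 ?_
        rw [hLn]
        have : (T : ℝ) / n ≤ L + 1 := by
          rw [div_le_iff₀ hn0]; nlinarith
        linarith
      have hLk : L ≤ L ^ k := le_self_pow₀ hL hk
      have hm : L / (3 * k.factorial)
          ≤ 1 / (k.factorial : ℝ) * n * L ^ k * Real.exp (-((T : ℝ) / n)) := by
        have h3 : (1 : ℝ) / 3 ≤ Real.exp (-1) := by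
          rw [Real.exp_neg, one_div]
          exact inv_anti₀ (Real.exp_pos _) Real.exp_one_lt_three.le
        calc L / (3 * k.factorial) = 1 / (k.factorial : ℝ) * L * (1 / 3) := by ring
          _ ≤ 1 / (k.factorial : ℝ) * L ^ k * (n * Real.exp (-((T : ℝ) / n))) := by
            gcongr
            exact h3.trans hexp
          _ = _ := by ring
      have hsmall : Real.exp (-(1 / (k.factorial : ℝ) * n * L ^ k * Real.exp (-((T : ℝ) / n))))
          ≤ 3 * k.factorial / L := by
        rw [Real.exp_neg, ← inv_div L]
        refine inv_anti₀ (by positivity) (hm.trans ?_)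
        linarith [Real.add_one_le_exp (1 / (k.factorial : ℝ) * n * L ^ k *
          Real.exp (-((T : ℝ) / n)))]
      have := Real.exp_pos (-(1 / (k.factorial : ℝ) * n * L ^ k * Real.exp (-((t : ℝ) / n))))
      calc g t ≤ g T := hg htT
        _ ≤ 3 * k.factorial / L + 1 / L := (hgexp T).trans (key.trans (by linarith))
        _ = (3 * k.factorial + 1) / L := by ring
        _ ≤ _ := by linarith
  -- For `t > 2 * n * L` the mean is at most `1 / L`, so the target exponential is at least `1 - 1 /
  -- L`.
  · push Not at ht'
    have hexp : n * Real.exp (-((t : ℝ) / n)) ≤ 1 / n := by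
      have : Real.exp (-((t : ℝ) / n)) ≤ Real.exp (-(L + L)) := by
        refine Real.exp_le_exp.2 (neg_le_neg ?_)
        rw [le_div_iff₀ hn0]; linarith
      rw [Real.exp_neg (L + L), Real.exp_add, hLn] at this
      calc _ ≤ n * ((n : ℝ) * n)⁻¹ := by gcongr
        _ = 1 / n := by field_simp
    have hpow : L ^ k * L ≤ n := by
      have h1 : L ^ (k + 1) ≤ L ^ (k + 2) := pow_le_pow_right₀ hL (by omega)
      have h2 : 0 ≤ L ^ (k + 2) := by positivity
      rw [← pow_succ]
      nlinarith [mul_nonneg (sq_nonneg (k : ℝ)) h2]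
    have hm : 1 / (k.factorial : ℝ) * n * L ^ k * Real.exp (-((t : ℝ) / n)) ≤ 1 / L := by
      calc _ = 1 / (k.factorial : ℝ) * L ^ k * (n * Real.exp (-((t : ℝ) / n))) := by ring
        _ ≤ 1 * L ^ k * (1 / n) := by
          gcongr
          rw [div_le_one (by linarith)]; exact hf1
        _ ≤ 1 / L := by
          rw [one_mul, mul_one_div, div_le_div_iff₀ hn0 hL0]; linarith
    have := Real.add_one_le_exp
      (-(1 / (k.factorial : ℝ) * n * L ^ k * Real.exp (-((t : ℝ) / n))))
    linarith [hg1 t]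

theorem eventually_mul_log_pow_le (A : ℝ) (m : ℕ) :
    ∀ᶠ n : ℕ in Filter.atTop, A * Real.log n ^ m ≤ n := by
  have h := (Real.isLittleO_pow_log_id_atTop (n := m)).const_mul_left A
  have h2 := (h.bound one_pos).and (Filter.eventually_ge_atTop 0)
  have h3 := tendsto_natCast_atTop_atTop.eventually h2
  filter_upwards [h3] with n hn
  obtain ⟨h4, h5⟩ := hn
  rw [one_mul, id, Real.norm_of_nonneg h5] at h4
  exact (le_abs_self _).trans h4

end Asymptotics

end CodingOverGenerations

/-! ### The main bound -/

theorem theorem7 (h : ℕ) (hh : 1 ≤ h) :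
    ∃ E : ℕ → ℝ,
      E =O[Filter.atTop] (fun n : ℕ => Real.log (Real.log n) / Real.log n) ∧
      ∀ (F : Type*) [Field F] [Fintype F] [MeasurableSpace F] [MeasurableSingletonClass F]
        (Ω : Type*) [MeasurableSpace Ω] (P : MeasureTheory.Measure Ω)
        [MeasureTheory.IsProbabilityMeasure P]
        (n : ℕ) (_ : 1 ≤ n) (X : ℕ → Ω → CodingOverGenerations.CodedPacket n h F)
        (_ : CodingOverGenerations.IsCodedStream P X) (t : ℕ),
        1 - Real.exp (-(1 / ((h - 1).factorial : ℝ) * n * Real.log n ^ (h - 1) *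
              Real.exp (-((t : ℝ) / n)))) + E n
          < CodingOverGenerations.failureProbability P X t := by
  classical
  obtain ⟨k, rfl⟩ : ∃ k, h = k + 1 := ⟨h - 1, by omega⟩
  have hlog : Filter.Tendsto (fun n : ℕ => Real.log n) Filter.atTop Filter.atTop :=
    Real.tendsto_log_atTop.comp tendsto_natCast_atTop_atTop
  -- The constant `3 * k! + 2` exceeds the proved `3 * k! + 1` to make the inequality strict. For
  -- the remaining `n`, the value `-2` makes the left side negative.
  refine ⟨fun n => if 1 ≤ Real.log n ∧ (8 + 2 * (k : ℝ) ^ 2) * Real.log n ^ (k + 2) ≤ n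
    then -((3 * k.factorial + 2) / Real.log n) else -2, ?_, ?_⟩
  · refine Asymptotics.IsBigO.of_bound (3 * k.factorial + 2) ?_
    filter_upwards [CodingOverGenerations.eventually_mul_log_pow_le (8 + 2 * (k : ℝ) ^ 2) (k + 2),
      hlog.eventually_ge_atTop 1, (Real.tendsto_log_atTop.comp hlog).eventually_ge_atTop 1]
      with n h1 h2 h3
    have h3' : 1 ≤ Real.log (Real.log n) := h3
    rw [if_pos ⟨h2, h1⟩, norm_neg, Real.norm_of_nonneg (by positivity),
      Real.norm_of_nonneg (by positivity), div_eq_mul_one_div]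
    gcongr
  · intro F _ _ _ _ Ω _ P _ n hn X hX t
    simp only [Nat.add_sub_cancel]
    have hfail := CodingOverGenerations.one_sub_le_failureProbability (P := P) hX.measurable t
    split_ifs with hc
    · have key := CodingOverGenerations.le_exp_neg_add_of_le_exp_neg_choose hn hc.1 hc.2
        (g := fun t => P.real
          {ω | ∀ j, k + 1 ≤ CodingOverGenerations.receivedCount (fun i => (X i ω).1) j t})
        (fun s t hst => MeasureTheory.measureReal_mono fun ω hω j =>
          (hω j).trans (CodingOverGenerations.receivedCount_mono _ j hst))
        (fun t => MeasureTheory.measureReal_le_one)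
        (fun t => CodingOverGenerations.IsCodedStream.measureReal_receivedCount_le_exp hX hn k t) t
      have hpos : 0 < 1 / Real.log n := by
        have := hc.1
        positivity
      have hadd : (3 * (k.factorial : ℝ) + 2) / Real.log n
          = (3 * k.factorial + 1) / Real.log n + 1 / Real.log n := by ring
      linarith
    · have h1 := Real.exp_pos (-(1 / (k.factorial : ℝ) * n * Real.log n ^ k *
        Real.exp (-((t : ℝ) / n))))
      have h2 : 0 ≤ CodingOverGenerations.failureProbability P X t :=
        MeasureTheory.measureReal_nonneg
      linarith
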